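/- Let $n\ge 1$ and equip $\mathbb{R}^{n+2}$, with coordinates $y^0,\dots,y^{n+1}$, with the metric $\eta=\mathrm{diag}(+,-,\dots,-,+)$. Let $f$ be a smooth function, homogeneous of degree $1$ (that is, $f(ty)=t f(y)$ for $t>0$), defined on an open set $U\subset\mathbb{R}^{n+2}$ that is stable under positive dilations, and let $$X_f=\{y\in U \mid \tfrac12\eta(y,y)=0,\ f(y)=1\},$$ an $n$-dimensional embedded submanifold of $\mathbb{R}^{n+2}$, with the induced metric $\eta_f$ (the pull-back of $\eta$ by the inclusion). (1) For every such $f$, either $X_f$ is empty, or $(X_f,\eta_f)$ is (locally) conformally flat: every point of $X_f$ lies in the domain of a smooth chart $e$ of $X_f$ with values in $\mathbb{R}^n$ on which $\eta_f=e^{2\psi}\,e^*\eta_{\mathrm{Mink}}$, with $\psi$ smooth and $\eta_{\mathrm{Mink}}=\mathrm{diag}(+,-,\dots,-)$. (2) Conversely, let $(M,g)$ be an $n$-dimensional globally conformally AdSM space, that is, a smooth manifold with metric such that there are a space $(\Sigma,g_\Sigma)$, a smooth function $\phi$ on $\Sigma$, and a diffeomorphism $\Xi:M\to\Sigma$ with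 $g=\Xi^*(e^{2\phi}g_\Sigma)$, where $(\Sigma,g_\Sigma)$ is one of the following: - de Sitter space $\{x\in\mathbb{R}^{n+1}\mid \langle x,x\rangle=-H^{-2}\}$ with the metric induced by $\langle\cdot,\cdot\rangle=\mathrm{diag}(+,-,\dots,-)$, for some $H>0$; - Minkowski space $(\mathbb{R}^n,\mathrm{diag}(+,-,\dots,-))$; - anti-de Sitter space $\{x\in\mathbb{R}^{n+1}\mid \langle x,x\rangle=H^{-2}\}$ with the metric induced by $\langle\cdot,\cdot\rangle=\mathrm{diag}(+,-,\dots,-,+)$, for some $H>0$. Then there exists a function $f$ as above (smooth and homogeneous of degree $1$ on some open conical domain) such that $(M,g)$ and $(X_f,\eta_f)$ are isometric, i.e. there is a diffeomorphism $\Phi:M\to X_f$ with $g=\Phi^*\eta_f$. -/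

import Mathlib

open scoped Manifold ContDiff RealInnerProductSpace

noncomputable section

namespace AdSM

/-! ## Metrics on manifolds -/

/-- The coordinate space `ℝᵐ` (its Euclidean structure serves only as topology and smooth
structure; the geometry comes from the forms `diagForm ε` below). -/
abbrev Coord (m : ℕ) : Type := EuclideanSpace ℝ (Fin m)

/-- A field of bilinear forms on the tangent spaces of an `n`-dimensional manifold. -/
abbrev MetricField (n : ℕ) (M : Type*) [TopologicalSpace M] [ChartedSpace (Coord n) M] : Type _ :=
  (x : M) → LinearMap.BilinForm ℝ (TangentSpace (𝓡 n) x)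

section Metric

variable {n m : ℕ} {M N : Type*} [TopologicalSpace M] [ChartedSpace (Coord n) M]
  [TopologicalSpace N] [ChartedSpace (Coord m) N]

/-- The pull-back `Φ^* h`. -/
def MetricField.pullback (Φ : M → N) (h : MetricField m N) : MetricField n M :=
  fun x => LinearMap.BilinForm.comp (h (Φ x))
    (mfderiv (𝓡 n) (𝓡 m) Φ x).toLinearMap (mfderiv (𝓡 n) (𝓡 m) Φ x).toLinearMap

/-- The rescaled field `e^{2φ} g`. -/
def MetricField.rescale (φ : M → ℝ) (g : MetricField n M) : MetricField n M :=
  fun x => Real.exp (2 * φ x) • g x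

end Metric

/-- The constant field on `ℝᵐ` given by a bilinear form, using `T_x ℝᵐ = ℝᵐ`. -/
def constField {m : ℕ} (B : LinearMap.BilinForm ℝ (Coord m)) : MetricField m (Coord m) :=
  fun _ => B

/-- The form `∑ i, ε i * x i * y i` on `ℝᵐ`. -/
def diagForm {m : ℕ} (ε : Fin m → ℝ) : LinearMap.BilinForm ℝ (Coord m) :=
  LinearMap.mk₂ ℝ (fun x y => ∑ i, ε i * x i * y i)
    (fun x x' y => by simp [mul_add, add_mul, Finset.sum_add_distrib])
    (fun c x y => by
      simp only [PiLp.smul_apply, smul_eq_mul, Finset.mul_sum]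
      exact Finset.sum_congr rfl fun i _ => by ring)
    (fun x y y' => by simp [mul_add, Finset.sum_add_distrib])
    (fun c x y => by
      simp only [PiLp.smul_apply, smul_eq_mul, Finset.mul_sum]
      exact Finset.sum_congr rfl fun i _ => by ring)

/-- Signs `(+ - ⋯ -)`. -/
def lorentzSign (m : ℕ) : Fin m → ℝ := fun i => if i.val = 0 then 1 else -1

/-- Signs `(+ - ⋯ - +)`. -/
def twoTimeSign (m : ℕ) : Fin m → ℝ := fun i => if i.val = 0 ∨ i.val + 1 = m then 1 else -1

/-- `(M, g)` and `(N, h)` are isometric through a smooth diffeomorphism. -/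
def IsIsometric {n : ℕ} {M N : Type*} [TopologicalSpace M] [ChartedSpace (Coord n) M]
    [TopologicalSpace N] [ChartedSpace (Coord n) N]
    (g : MetricField n M) (h : MetricField n N) : Prop :=
  ∃ Φ : Diffeomorph (𝓡 n) (𝓡 n) M N ∞, g = MetricField.pullback Φ h

/-- `(M, g)` is isometric to `(N, e^{2φ} h)` for some smooth `φ` on `N`. -/
def IsGloballyConformalTo {n : ℕ} {M N : Type*} [TopologicalSpace M] [ChartedSpace (Coord n) M]
    [TopologicalSpace N] [ChartedSpace (Coord n) N]
    (g : MetricField n M) (h : MetricField n N) : Prop :=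
  ∃ φ : N → ℝ, ContMDiff (𝓡 n) 𝓘(ℝ, ℝ) ∞ φ ∧ IsIsometric g (MetricField.rescale φ h)

/-- The metric of Minkowski space `ℝⁿ`, `(+ - ⋯ -)`. -/
def minkowskiMetric (n : ℕ) : MetricField n (Coord n) := constField (diagForm (lorentzSign n))

/-- (Local) conformal flatness, in Lorentzian signature `(+ - ⋯ -)`: around every point there is
a smooth chart `e` in which `g` is a smooth positive multiple of the Minkowski metric. -/
def IsConformallyFlat {n : ℕ} {M : Type*} [TopologicalSpace M] [ChartedSpace (Coord n) M]
    (g : MetricField n M) : Prop :=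
  ∀ x : M, ∃ e ∈ IsManifold.maximalAtlas (𝓡 n) ∞ M, x ∈ e.source ∧
    ∃ ψ : M → ℝ, ContMDiffOn (𝓡 n) 𝓘(ℝ, ℝ) ∞ ψ e.source ∧
      ∀ y ∈ e.source,
        g y = MetricField.rescale ψ (MetricField.pullback e (minkowskiMetric n)) y

/-! ## Embedded submanifolds of `ℝᵐ` -/

/-- The smooth charts of a subset `S` of `ℝᵐ`: homeomorphisms between an open subset of `S` and
an open subset of `ℝⁿ` that are given by a smooth map of the ambient space and whose inverse is
smooth as a map into the ambient space. -/
def submanifoldAtlas (n : ℕ) {m : ℕ} (S : Set (Coord m)) :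
    Set (OpenPartialHomeomorph S (Coord n)) :=
  {e | ContDiffOn ℝ ∞ (fun u => (e.symm u : Coord m)) e.target ∧
    ∃ (V : Set (Coord m)) (r : Coord m → Coord n), IsOpen V ∧ ContDiffOn ℝ ∞ r V ∧
      ∀ p ∈ e.source, (p : Coord m) ∈ V ∧ e p = r p}

/-- `S` is an `n`-dimensional embedded submanifold of `ℝᵐ`. -/
def IsSubmanifold (n : ℕ) {m : ℕ} (S : Set (Coord m)) : Prop :=
  ∀ p : S, ∃ e ∈ submanifoldAtlas n S, p ∈ e.source

/-- The charted space structure of an embedded submanifold. -/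
@[reducible] def submanifoldChartedSpace {n m : ℕ} {S : Set (Coord m)} (h : IsSubmanifold n S) :
    ChartedSpace (Coord n) S where
  atlas := submanifoldAtlas n S
  chartAt p := (h p).choose
  mem_chart_source p := (h p).choose_spec.2
  chart_mem_atlas p := (h p).choose_spec.1

theorem submanifold_isManifold {n m : ℕ} {S : Set (Coord m)} (h : IsSubmanifold n S) :
    letI := submanifoldChartedSpace h
    IsManifold (𝓡 n) ∞ S := by
  let := submanifoldChartedSpace h
  refine isManifold_of_contDiffOn _ _ _ ?_
  rintro e e' ⟨he, -⟩ ⟨-, V, r, -, hr, hV⟩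
  simp only [modelWithCornersSelf_coe, modelWithCornersSelf_coe_symm, Function.comp_id,
    Function.id_comp, Set.preimage_id, Set.range_id, Set.inter_univ]
  have hs : (e.symm.trans e').source ⊆ e.target := by
    intro u hu
    simp only [OpenPartialHomeomorph.trans_source, OpenPartialHomeomorph.symm_source] at hu
    exact hu.1
  have hs' : ∀ u ∈ (e.symm.trans e').source, e.symm u ∈ e'.source := by
    intro u hu
    simp only [OpenPartialHomeomorph.trans_source] at hu
    exact hu.2
  refine (ContDiffOn.comp hr (he.mono hs) fun u hu => (hV _ (hs' u hu)).1).congr ?_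
  intro u hu
  exact (hV _ (hs' u hu)).2

/-- A smooth local parametrization with smooth left inverse yields a chart. -/
theorem exists_chart {n m : ℕ} {S : Set (Coord m)} (p : S)
    {V : Set (Coord m)} {r : Coord m → Coord n} {T : Set (Coord n)} {s : Coord n → Coord m}
    (hV : IsOpen V) (hT : IsOpen T) (hr : ContDiffOn ℝ ∞ r V) (hs : ContDiffOn ℝ ∞ s T)
    (hp : (p : Coord m) ∈ V)
    (hrs : ∀ y ∈ S, y ∈ V → r y ∈ T ∧ s (r y) = y)
    (hsr : ∀ u ∈ T, s u ∈ S ∧ s u ∈ V ∧ r (s u) = u) :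
    ∃ e ∈ submanifoldAtlas n S, p ∈ e.source := by
  classical
  let e : OpenPartialHomeomorph S (Coord n) :=
    { toFun := fun y => r y
      invFun := fun u => if h : u ∈ T then ⟨s u, (hsr u h).1⟩ else p
      source := {y | (y : Coord m) ∈ V}
      target := T
      map_source' := fun y hy => (hrs y y.2 hy).1
      map_target' := fun u hu => by
        simp only [hu, dif_pos, Set.mem_ofPred_eq]; exact (hsr u hu).2.1
      left_inv' := fun y hy => by
        have h := hrs y y.2 hy
        simp only [h.1, dif_pos]
        exact Subtype.ext h.2
      right_inv' := fun u hu => by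
        simp only [hu, dif_pos]; exact (hsr u hu).2.2
      open_source := hV.preimage continuous_subtype_val
      open_target := hT
      continuousOn_toFun := hr.continuousOn.comp continuous_subtype_val.continuousOn
        (fun y hy => hy)
      continuousOn_invFun := by
        rw [Topology.IsInducing.subtypeVal.continuousOn_iff]
        refine hs.continuousOn.congr fun u hu => ?_
        simp [hu] }
  refine ⟨e, ⟨?_, V, r, hV, hr, fun y hy => ⟨hy, rfl⟩⟩, hp⟩
  refine hs.congr fun u hu => ?_
  have hu' : u ∈ T := hu
  change ((if h : u ∈ T then (⟨s u, (hsr u h).1⟩ : S) else p : S) : Coord m) = s u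
  simp [hu']

/-! ## De Sitter and anti-de Sitter spaces -/

theorem diagForm_apply {m : ℕ} (ε : Fin m → ℝ) (x y : Coord m) :
    diagForm ε x y = ∑ i, ε i * x i * y i := rfl

theorem diagForm_comm {m : ℕ} (ε : Fin m → ℝ) (x y : Coord m) :
    diagForm ε x y = diagForm ε y x := by
  simp only [diagForm_apply]
  exact Finset.sum_congr rfl fun i _ => by ring

/-- The vector with `⟪diagDual ε x, y⟫ = diagForm ε x y`. -/
def diagDual {m : ℕ} (ε : Fin m → ℝ) (x : Coord m) : Coord m :=
  WithLp.toLp 2 fun i => ε i * x i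

theorem inner_diagDual {m : ℕ} (ε : Fin m → ℝ) (x y : Coord m) :
    ⟪diagDual ε x, y⟫ = diagForm ε x y := by
  simp only [diagForm_apply, diagDual, PiLp.inner_apply]
  exact Finset.sum_congr rfl fun i _ => by simp [mul_comm]

theorem contDiff_diagForm {m : ℕ} (ε : Fin m → ℝ) :
    ContDiff ℝ ∞ (fun x : Coord m => diagForm ε x x) := by
  simp only [diagForm_apply]
  fun_prop

/-- The quadric `a * diagForm ε x x = 1`. -/
def quadric {m : ℕ} (ε : Fin m → ℝ) (a : ℝ) : Set (Coord m) := {x | a * diagForm ε x x = 1}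

theorem quadric_isSubmanifold {m : ℕ} (ε : Fin (m + 1) → ℝ) (a : ℝ) :
    IsSubmanifold m (quadric ε a) := by
  intro p
  obtain ⟨x₀, hx₀⟩ := p
  have hx : a * diagForm ε x₀ x₀ = 1 := hx₀
  set q := diagDual ε x₀ with hq
  have hq0 : q ≠ 0 := by
    intro h
    have : diagForm ε x₀ x₀ = 0 := by rw [← inner_diagDual, ← hq, h, inner_zero_left]
    rw [this] at hx; simp at hx
  have : Fact (Module.finrank ℝ (Coord (m + 1)) = m + 1) := ⟨by simp⟩
  let W := (Submodule.span ℝ {q})ᗮ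
  have hW : Module.finrank ℝ W = m := Submodule.finrank_orthogonal_span_singleton hq0
  have memW : ∀ w, w ∈ W ↔ diagForm ε x₀ w = 0 := by
    intro w
    rw [Submodule.mem_orthogonal_singleton_iff_inner_right, hq, inner_diagDual]
  let L : Coord m ≃L[ℝ] W := ContinuousLinearEquiv.ofFinrankEq (by simp [hW])
  let P : Coord (m + 1) →L[ℝ] W := W.orthogonalProjectionOnto
  have hP : ∀ w (h : w ∈ W), P w = ⟨w, h⟩ := fun w h =>
    Submodule.orthogonalProjectionOnto_mem_subspace_eq_self (⟨w, h⟩ : W)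
  refine exists_chart (V := {y | 0 < a * ⟪q, y⟫})
    (r := fun y => L.symm (P (y - (a * ⟪q, y⟫) • x₀)))
    (T := {u | a * diagForm ε (L u : Coord (m + 1)) (L u : Coord (m + 1)) < 1})
    (s := fun u => Real.sqrt (1 - a * diagForm ε (L u : Coord (m + 1)) (L u : Coord (m + 1))) • x₀
      + (L u : Coord (m + 1))) ⟨x₀, hx₀⟩ ?_ ?_ ?_ ?_ ?_ ?_ ?_
  · exact isOpen_lt continuous_const (by fun_prop)
  · refine isOpen_lt (continuous_const.mul ((contDiff_diagForm ε).continuous.comp ?_))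
      continuous_const
    exact continuous_subtype_val.comp L.continuous
  · refine ContDiff.contDiffOn (L.symm.contDiff.comp (P.contDiff.comp ?_))
    have : ContDiff ℝ ∞ fun y : Coord (m + 1) => ⟪q, y⟫ := contDiff_const.inner ℝ contDiff_id
    fun_prop
  · have hL : ContDiff ℝ ∞ fun u => (L u : Coord (m + 1)) :=
      W.subtypeL.contDiff.comp L.contDiff
    have h1 : ContDiff ℝ ∞ fun u =>
        1 - a * diagForm ε (L u : Coord (m + 1)) (L u : Coord (m + 1)) :=
      contDiff_const.sub (contDiff_const.mul ((contDiff_diagForm ε).comp hL))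
    refine ContDiffOn.add (ContDiffOn.smul (h1.contDiffOn.sqrt ?_) contDiffOn_const) hL.contDiffOn
    intro u hu
    have : a * diagForm ε (L u : Coord (m + 1)) (L u : Coord (m + 1)) < 1 := hu
    linarith
  · change 0 < a * ⟪q, x₀⟫
    rw [hq, inner_diagDual, hx]; norm_num
  · intro y hy hyV
    have hyV' : 0 < a * ⟪q, y⟫ := hyV
    have hyS : a * diagForm ε y y = 1 := hy
    rw [hq, inner_diagDual] at hyV'
    simp only [hq, inner_diagDual, Set.mem_ofPred_eq]
    set α := a * diagForm ε x₀ y with hα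
    have hw : y - α • x₀ ∈ W := by
      rw [memW]; simp only [map_sub, map_smul, smul_eq_mul]
      rw [hα]; linear_combination -(diagForm ε x₀ y) * hx
    rw [hP _ hw]
    simp only [ContinuousLinearEquiv.apply_symm_apply]
    have key : a * diagForm ε (y - α • x₀) (y - α • x₀) = 1 - α ^ 2 := by
      simp only [map_sub, map_smul, smul_eq_mul, LinearMap.sub_apply, LinearMap.smul_apply]
      rw [diagForm_comm ε y x₀]
      have : a * diagForm ε x₀ y = α := rfl
      linear_combination hyS + α ^ 2 * hx - 2 * α * this
    refine ⟨by rw [key]; nlinarith, ?_⟩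
    rw [key]
    have : Real.sqrt (1 - (1 - α ^ 2)) = α := by
      rw [show 1 - (1 - α ^ 2) = α ^ 2 by ring, Real.sqrt_sq hyV'.le]
    rw [this]; abel
  · intro u hu
    have hu' : a * diagForm ε (L u : Coord (m + 1)) (L u : Coord (m + 1)) < 1 := hu
    have hLu : diagForm ε x₀ (L u : Coord (m + 1)) = 0 := (memW _).1 (L u).2
    set w : Coord (m + 1) := (L u : Coord (m + 1)) with hw
    set σ := Real.sqrt (1 - a * diagForm ε w w) with hσ
    have hσ0 : 0 < σ := Real.sqrt_pos.2 (by linarith)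
    have hσ2 : σ ^ 2 = 1 - a * diagForm ε w w := Real.sq_sqrt (by linarith)
    have hα : a * diagForm ε x₀ (σ • x₀ + w) = σ := by
      simp only [map_add, map_smul, smul_eq_mul, hLu]
      linear_combination σ * hx
    refine ⟨?_, ?_, ?_⟩
    · change a * diagForm ε (σ • x₀ + w) (σ • x₀ + w) = 1
      simp only [map_add, map_smul, smul_eq_mul, LinearMap.add_apply, LinearMap.smul_apply]
      rw [diagForm_comm ε w x₀, hLu]
      linear_combination hσ2 + σ ^ 2 * hx
    · change 0 < a * ⟪q, σ • x₀ + w⟫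
      rw [hq, inner_diagDual, hα]; exact hσ0
    · simp only [hq, inner_diagDual]
      rw [hα, add_sub_cancel_left, hP w (L u).2]
      exact L.symm_apply_apply u

/-- De Sitter space of curvature parameter `κ = H²`: the hyperboloid `⟨x, x⟩ = -1/H²` in
`ℝⁿ⁺¹` with signature `(+ - ⋯ -)`. -/
def deSitter (n : ℕ) (H : ℝ) : Set (Coord (n + 1)) := quadric (lorentzSign (n + 1)) (-H ^ 2)

/-- Anti-de Sitter space of curvature parameter `κ = -H²`: the hyperboloid `⟨x, x⟩ = 1/H²` in
`ℝⁿ⁺¹` with signature `(+ - ⋯ - +)`. -/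
def antiDeSitter (n : ℕ) (H : ℝ) : Set (Coord (n + 1)) := quadric (twoTimeSign (n + 1)) (H ^ 2)

instance (n : ℕ) (H : ℝ) : ChartedSpace (Coord n) (deSitter n H) :=
  submanifoldChartedSpace (quadric_isSubmanifold _ _)

instance (n : ℕ) (H : ℝ) : IsManifold (𝓡 n) ∞ (deSitter n H) :=
  submanifold_isManifold (quadric_isSubmanifold _ _)

instance (n : ℕ) (H : ℝ) : ChartedSpace (Coord n) (antiDeSitter n H) :=
  submanifoldChartedSpace (quadric_isSubmanifold _ _)

instance (n : ℕ) (H : ℝ) : IsManifold (𝓡 n) ∞ (antiDeSitter n H) :=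
  submanifold_isManifold (quadric_isSubmanifold _ _)

/-- The metric induced on de Sitter space. -/
def deSitterMetric (n : ℕ) (H : ℝ) : MetricField n (deSitter n H) :=
  MetricField.pullback Subtype.val (constField (diagForm (lorentzSign (n + 1))))

/-- The metric induced on anti-de Sitter space. -/
def antiDeSitterMetric (n : ℕ) (H : ℝ) : MetricField n (antiDeSitter n H) :=
  MetricField.pullback Subtype.val (constField (diagForm (twoTimeSign (n + 1))))

/-- `(M, g)` is globally conformally AdSM: isometric to `(Σ, e^{2φ} g_Σ)` with `Σ` a de Sitter,
Minkowski or anti-de Sitter space and `φ` a smooth function on `Σ`. -/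
def IsGloballyConformallyAdSM {n : ℕ} {M : Type*} [TopologicalSpace M] [ChartedSpace (Coord n) M]
    (g : MetricField n M) : Prop :=
  (∃ H : ℝ, 0 < H ∧ IsGloballyConformalTo g (deSitterMetric n H)) ∨
  IsGloballyConformalTo g (minkowskiMetric n) ∨
  (∃ H : ℝ, 0 < H ∧ IsGloballyConformalTo g (antiDeSitterMetric n H))

/-! ## The spaces `X_f` -/

/-- The ambient metric `η = diag(+ - ⋯ - +)` of `ℝⁿ⁺²`. -/
def ambientForm (n : ℕ) : LinearMap.BilinForm ℝ (Coord (n + 2)) := diagForm (twoTimeSign (n + 2))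

/-- A smooth (positively) homogeneous function of degree one on an open conical domain of `ℝⁿ⁺²`.
Only the values on the domain matter. -/
structure HomogeneousFunction (n : ℕ) where
  domain : Set (Coord (n + 2))
  toFun : Coord (n + 2) → ℝ
  isOpen_domain : IsOpen domain
  smul_mem : ∀ t : ℝ, 0 < t → ∀ y ∈ domain, t • y ∈ domain
  contDiffOn : ContDiffOn ℝ ∞ toFun domain
  map_smul : ∀ t : ℝ, 0 < t → ∀ y ∈ domain, toFun (t • y) = t * toFun y

/-- The null cone `c(y) = η(y, y) / 2 = 0`. -/
def nullCone (n : ℕ) : Set (Coord (n + 2)) := {y | 1 / 2 * ambientForm n y y = 0}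

/-- The hypersurface `f = 1`. -/
def HomogeneousFunction.levelSet {n : ℕ} (f : HomogeneousFunction n) : Set (Coord (n + 2)) :=
  {y | y ∈ f.domain ∧ f.toFun y = 1}

/-- `X_f`, the intersection of the null cone and the hypersurface `f = 1`. -/
def HomogeneousFunction.X {n : ℕ} (f : HomogeneousFunction n) : Set (Coord (n + 2)) :=
  nullCone n ∩ f.levelSet

theorem X_isSubmanifold {n : ℕ} (f : HomogeneousFunction n) : IsSubmanifold n f.X := by
  intro p
  obtain ⟨y₀, hy₀⟩ := p
  have hsq : ∀ i, twoTimeSign (n + 2) i * twoTimeSign (n + 2) i = 1 := by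
    intro i; unfold twoTimeSign; split_ifs <;> norm_num
  set ε := twoTimeSign (n + 2) with hε
  have hcone : diagForm ε y₀ y₀ = 0 := by
    have h : 1 / 2 * diagForm ε y₀ y₀ = 0 := hy₀.1
    linarith
  obtain ⟨hyU, hfy⟩ := hy₀.2
  have hy0 : y₀ ≠ 0 := by
    rintro h
    have h2 := f.map_smul 2 (by norm_num) y₀ hyU
    rw [h, smul_zero, ← h, hfy] at h2
    norm_num at h2
  set q := diagDual ε y₀ with hq
  have hqq : diagDual ε q = y₀ := by
    ext i; simp [hq, diagDual, ← mul_assoc, hsq]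
  have hiq : ∀ y, ⟪q, y⟫ = diagForm ε y₀ y := inner_diagDual ε y₀
  have hiy : ∀ y, ⟪y₀, y⟫ = diagForm ε q y := fun y => by rw [← inner_diagDual, hqq]
  set K := ⟪y₀, y₀⟫ with hK
  have hK0 : 0 < K := real_inner_self_pos.2 hy0
  have hqy : diagForm ε q y₀ = K := (hiy y₀).symm
  have hyq : diagForm ε y₀ q = K := by rw [diagForm_comm, hqy]
  have hq_q : diagForm ε q q = 0 := by rw [← hiy, real_inner_comm, hiq, hcone]
  have hq0 : q ≠ 0 := by
    intro h; rw [h, map_zero, LinearMap.zero_apply] at hqy; exact hK0.ne hqy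
  let W := (Submodule.span ℝ (Set.range ![y₀, q]))ᗮ
  have hlin : LinearIndependent ℝ ![y₀, q] := by
    refine linearIndependent_of_ne_zero_of_inner_eq_zero (𝕜 := ℝ) ?_ ?_
    · intro i; fin_cases i
      · exact hy0
      · exact hq0
    · intro i j hij
      have h1 : ⟪y₀, q⟫ = 0 := by rw [hiy, hq_q]
      have h2 : ⟪q, y₀⟫ = 0 := by rw [hiq, hcone]
      fin_cases i <;> fin_cases j <;> simp_all
  have hW : Module.finrank ℝ W = n := by
    have h1 := Submodule.finrank_add_finrank_orthogonal (Submodule.span ℝ (Set.range ![y₀, q]))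
    rw [finrank_span_eq_card hlin] at h1
    simp only [Fintype.card_fin, finrank_euclideanSpace] at h1
    change Module.finrank ℝ (Submodule.span ℝ (Set.range ![y₀, q]))ᗮ = n
    omega
  have memW : ∀ w, w ∈ W ↔ diagForm ε q w = 0 ∧ diagForm ε y₀ w = 0 := by
    intro w
    rw [← hiy, ← hiq]
    constructor
    · intro h
      exact ⟨(Submodule.mem_orthogonal _ _).1 h _ (Submodule.subset_span ⟨0, rfl⟩),
        (Submodule.mem_orthogonal _ _).1 h _ (Submodule.subset_span ⟨1, rfl⟩)⟩
    · rintro ⟨h1, h2⟩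
      refine (Submodule.mem_orthogonal _ _).2 fun v hv => ?_
      induction hv using Submodule.span_induction with
      | mem v hv =>
        obtain ⟨i, rfl⟩ := hv
        fin_cases i
        · exact h1
        · exact h2
      | zero => exact inner_zero_left _
      | add a b _ _ ha hb => rw [inner_add_left, ha, hb, add_zero]
      | smul c a _ ha => rw [inner_smul_left, ha, mul_zero]
  let L : Coord n ≃L[ℝ] W := ContinuousLinearEquiv.ofFinrankEq (by simp [hW])
  let P : Coord (n + 2) →L[ℝ] W := W.orthogonalProjectionOnto
  have hP : ∀ w (h : w ∈ W), P w = ⟨w, h⟩ := fun w h =>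
    Submodule.orthogonalProjectionOnto_mem_subspace_eq_self (⟨w, h⟩ : W)
  have hPy : P y₀ = 0 := Submodule.orthogonalProjectionOnto_orthogonal_apply_eq_zero
    (Submodule.subset_span ⟨0, rfl⟩)
  have hPq : P q = 0 := Submodule.orthogonalProjectionOnto_orthogonal_apply_eq_zero
    (Submodule.subset_span ⟨1, rfl⟩)
  let s₀ : Coord n → Coord (n + 2) := fun u =>
    y₀ + (L u : Coord (n + 2)) -
      (diagForm ε (L u : Coord (n + 2)) (L u : Coord (n + 2)) / (2 * K)) • q
  have hL : ContDiff ℝ ∞ fun u => (L u : Coord (n + 2)) :=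
    W.subtypeL.contDiff.comp L.contDiff
  have hs₀ : ContDiff ℝ ∞ s₀ := by
    have h1 : ContDiff ℝ ∞ fun u =>
        diagForm ε (L u : Coord (n + 2)) (L u : Coord (n + 2)) / (2 * K) :=
      ((contDiff_diagForm ε).comp hL).div_const _
    exact (contDiff_const.add hL).sub (h1.smul contDiff_const)
  have hinner : ContDiff ℝ ∞ fun y : Coord (n + 2) => ⟪y₀, y⟫ :=
    contDiff_const.inner ℝ contDiff_id
  have hs₀y : ∀ u, ⟪y₀, s₀ u⟫ = K := by
    intro u
    have hm := (memW _).1 (L u).2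
    simp only [s₀, hiy, map_add, map_sub, map_smul, hq_q, hm.1, hqy]
    simp
  have hs₀c : ∀ u, diagForm ε (s₀ u) (s₀ u) = 0 := by
    intro u
    have hm := (memW _).1 (L u).2
    have hm1 := hm.1
    have hm2 := hm.2
    rw [diagForm_comm] at hm1 hm2
    simp only [s₀, map_add, map_sub, map_smul, hq_q, hm.1, hm.2, hm1, hm2, hqy, hyq, hcone,
      LinearMap.add_apply, LinearMap.sub_apply, LinearMap.smul_apply, smul_eq_mul]
    field_simp
    ring
  have hT : IsOpen {u | s₀ u ∈ f.domain ∧ 0 < f.toFun (s₀ u)} := by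
    have h1 : IsOpen (f.domain ∩ f.toFun ⁻¹' Set.Ioi 0) :=
      f.contDiffOn.continuousOn.isOpen_inter_preimage f.isOpen_domain isOpen_Ioi
    exact h1.preimage hs₀.continuous
  refine exists_chart (V := {y | 0 < ⟪y₀, y⟫})
    (r := fun y => L.symm (P ((K / ⟪y₀, y⟫) • y)))
    (T := {u | s₀ u ∈ f.domain ∧ 0 < f.toFun (s₀ u)})
    (s := fun u => (f.toFun (s₀ u))⁻¹ • s₀ u) ⟨y₀, hy₀⟩ ?_ hT ?_ ?_ hK0 ?_ ?_
  · exact isOpen_lt continuous_const hinner.continuous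
  · refine (L.symm.contDiff.comp P.contDiff).comp_contDiffOn ?_
    refine ContDiffOn.smul (contDiffOn_const.div hinner.contDiffOn ?_) contDiffOn_id
    intro y hy
    exact ne_of_gt hy
  · have h1 : ContDiffOn ℝ ∞ (fun u => f.toFun (s₀ u))
        {u | s₀ u ∈ f.domain ∧ 0 < f.toFun (s₀ u)} :=
      f.contDiffOn.comp hs₀.contDiffOn fun u hu => hu.1
    exact (h1.inv fun u hu => ne_of_gt hu.2).smul hs₀.contDiffOn
  · intro y hy hyV
    have hc : diagForm ε y y = 0 := by
      have h : 1 / 2 * diagForm ε y y = 0 := hy.1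
      linarith
    obtain ⟨hyd, hf1⟩ := hy.2
    have hpos : 0 < ⟪y₀, y⟫ := hyV
    set t := K / ⟪y₀, y⟫ with ht
    have ht0 : 0 < t := div_pos hK0 hpos
    have htc : t * diagForm ε q y = K := by
      rw [← hiy, ht]; field_simp
    -- decomposition of the rescaled point along `y₀`, `q` and `W`
    set b := t * diagForm ε y₀ y / K with hb
    have hbK : b * K = t * diagForm ε y₀ y := by rw [hb]; field_simp
    have hw : t • y - y₀ - b • q ∈ W := by
      rw [memW]
      simp only [map_sub, map_smul, smul_eq_mul, hq_q, hqy, hyq, hcone]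
      constructor
      · linear_combination htc
      · linear_combination -hbK
    have hPw : P (t • y) = ⟨t • y - y₀ - b • q, hw⟩ := by
      rw [← hP _ hw]; simp [hPy, hPq]
    have hww : diagForm ε (t • y - y₀ - b • q) (t • y - y₀ - b • q) = -(2 * K) * b := by
      simp only [map_sub, map_smul, LinearMap.sub_apply, LinearMap.smul_apply, smul_eq_mul,
        hq_q, hqy, hyq, hcone, hc]
      rw [diagForm_comm ε y y₀, diagForm_comm ε y q]
      linear_combination (-2 * b) * htc + 2 * hbK
    have hs : s₀ (L.symm (P (t • y))) = t • y := by
      simp only [s₀, ContinuousLinearEquiv.apply_symm_apply]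
      rw [hPw]
      simp only
      rw [hww]
      have : -(2 * K) * b / (2 * K) = -b := by field_simp
      rw [this]; module
    have hft : f.toFun (t • y) = t := by rw [f.map_smul t ht0 y hyd, hf1, mul_one]
    refine ⟨⟨?_, ?_⟩, ?_⟩
    · rw [hs]; exact f.smul_mem t ht0 y hyd
    · rw [hs, hft]; exact ht0
    · rw [hs, hft, smul_smul, inv_mul_cancel₀ ht0.ne', one_smul]
  · rintro u ⟨hu, hu0⟩
    have hi : 0 < (f.toFun (s₀ u))⁻¹ := inv_pos.2 hu0
    refine ⟨⟨?_, f.smul_mem _ hi _ hu, ?_⟩, ?_, ?_⟩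
    · change 1 / 2 * diagForm ε _ _ = 0
      simp [hs₀c]
    · rw [f.map_smul _ hi _ hu, inv_mul_cancel₀ hu0.ne']
    · change 0 < ⟪y₀, (f.toFun (s₀ u))⁻¹ • s₀ u⟫
      rw [inner_smul_right, hs₀y]; positivity
    · have h1 : (K / ⟪y₀, (f.toFun (s₀ u))⁻¹ • s₀ u⟫) • (f.toFun (s₀ u))⁻¹ • s₀ u = s₀ u := by
        rw [inner_smul_right, hs₀y, smul_smul]
        convert one_smul ℝ (s₀ u)
        field_simp
      simp only [h1]
      have h2 : P (s₀ u) = L u := by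
        simp only [s₀, map_add, map_sub, map_smul, hPy, hPq]
        simp [hP _ (L u).2]
      rw [h2]; exact L.symm_apply_apply u

instance {n : ℕ} (f : HomogeneousFunction n) : ChartedSpace (Coord n) f.X :=
  submanifoldChartedSpace (X_isSubmanifold f)

instance {n : ℕ} (f : HomogeneousFunction n) : IsManifold (𝓡 n) ∞ f.X :=
  submanifold_isManifold (X_isSubmanifold f)

/-- The metric `η_f` induced on `X_f`, the pull-back of `η` by the inclusion. -/
def HomogeneousFunction.inducedMetric {n : ℕ} (f : HomogeneousFunction n) : MetricField n f.X :=
  MetricField.pullback Subtype.val (constField (ambientForm n))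

end AdSM

end

/-! Since `f` has degree one, `X_f` meets each ray of the null cone at most once: it is a section of
part of the cone of rays. All sections induce the same conformal class. If `h` takes null values,
differentiating `η(h, h) = 0` gives `η(h, dh) = 0`, so in `d(l h) = l dh + dl h` the second term is
invisible to `η` and `(l h)^* η = l² h^* η` (`diagForm_mfderiv_smul`).

Flatness. Write `η = 2 a b + ⟨w, w⟩` with `w` in Minkowski space. The section `a = 1` of the cone is
the paraboloid `x ↦ (1, -⟨x, x⟩/2, x)`, which induces exactly the Minkowski metric. A point of `X_f`
with `a > 0` is `a` times the paraboloid point over `w / a`, so `w / a` is a chart with conformal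
factor `a²`. Every nonzero null vector has `a > 0` in suitable null coordinates
(`NullFrame.exists_pos`).

Converse. Each model space is itself a section `σ` of the cone: Minkowski space is the paraboloid,
while de Sitter and anti-de Sitter spaces are hyperplane slices where one coordinate equals `1/H`.
If `y = lam y • σ (π y)` on the cone, then `f = lam · e^(-φ ∘ π)` is homogeneous of degree one and
`X_f` is the image of `e^φ σ`, with metric `e^(2φ) σ^* η` (`ConeSection.isIsometric_X`). -/

noncomputable section

namespace AdSM

/-! ### Smooth maps into and out of embedded submanifolds -/

section Submanifold

variable {n m : ℕ} {S : Set (Coord m)}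

theorem contMDiff_subtype_val (h : IsSubmanifold n S) :
    letI := submanifoldChartedSpace h
    ContMDiff (𝓡 n) (𝓡 m) ∞ (Subtype.val : S → Coord m) := by
  let := submanifoldChartedSpace h
  have := submanifold_isManifold h
  intro p
  obtain ⟨e, he, hp⟩ := h p
  have hmax : e ∈ IsManifold.maximalAtlas (𝓡 n) ∞ S :=
    IsManifold.subset_maximalAtlas he
  have h1 : ContMDiffAt (𝓡 n) (𝓡 n) ∞ e p :=
    (contMDiffOn_of_mem_maximalAtlas hmax).contMDiffAt (e.open_source.mem_nhds hp)
  have h2 : ContMDiffAt (𝓡 n) (𝓡 m) ∞ (fun u => (e.symm u : Coord m)) (e p) :=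
    (he.1.contDiffAt (e.open_target.mem_nhds (e.map_source hp))).contMDiffAt
  refine (h2.comp p h1).congr_of_eventuallyEq ?_
  filter_upwards [e.open_source.mem_nhds hp] with y hy
  simp [e.left_inv hy]

/-- A chart `e` is the restriction of an ambient smooth map `r`, so near `x` the map `F` equals
`e.symm ∘ r ∘ F`, where only the ambient version of `F` is differentiated. -/
theorem contMDiffAt_submanifold (h : IsSubmanifold n S) {k : ℕ} {N : Type*} [TopologicalSpace N]
    [ChartedSpace (Coord k) N] {F : N → S} {x : N}
    (hF : ContMDiffAt (𝓡 k) (𝓡 m) ∞ (fun z => (F z : Coord m)) x) :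
    letI := submanifoldChartedSpace h
    ContMDiffAt (𝓡 k) (𝓡 n) ∞ F x := by
  let := submanifoldChartedSpace h
  have := submanifold_isManifold h
  obtain ⟨e, he, hp⟩ := h (F x)
  have hmax : e ∈ IsManifold.maximalAtlas (𝓡 n) ∞ S :=
    IsManifold.subset_maximalAtlas he
  obtain ⟨V, r, hV, hr, heq⟩ := he.2
  have hcont : ContinuousAt F x := by
    rw [Topology.IsInducing.subtypeVal.continuousAt_iff]
    exact hF.continuousAt
  have h1 : ContMDiffAt (𝓡 m) (𝓡 n) ∞ r (F x : Coord m) :=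
    (hr.contDiffAt (hV.mem_nhds (heq _ hp).1)).contMDiffAt
  have h2 : ContMDiffAt (𝓡 n) (𝓡 n) ∞ e.symm (r (F x : Coord m)) := by
    rw [← (heq _ hp).2]
    exact (contMDiffOn_symm_of_mem_maximalAtlas hmax).contMDiffAt
      (e.open_target.mem_nhds (e.map_source hp))
  refine (h2.comp x (h1.comp x hF)).congr_of_eventuallyEq ?_
  filter_upwards [hcont.preimage_mem_nhds (e.open_source.mem_nhds hp)] with y hy
  have hy' : F y ∈ e.source := hy
  simp [← (heq _ hy').2, e.left_inv hy']

/-- A smooth local parametrization with smooth left inverse `r` yields a chart given by `r`. -/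
theorem exists_chart_eq (p : S)
    {V : Set (Coord m)} {r : Coord m → Coord n} {T : Set (Coord n)} {s : Coord n → Coord m}
    (hV : IsOpen V) (hT : IsOpen T) (hr : ContDiffOn ℝ ∞ r V) (hs : ContDiffOn ℝ ∞ s T)
    (hrs : ∀ y ∈ S, y ∈ V → r y ∈ T ∧ s (r y) = y)
    (hsr : ∀ u ∈ T, s u ∈ S ∧ s u ∈ V ∧ r (s u) = u) :
    ∃ e ∈ submanifoldAtlas n S, e.source = {y : S | (y : Coord m) ∈ V} ∧
      ∀ y : S, e y = r y := by
  classical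
  let e : OpenPartialHomeomorph S (Coord n) :=
    { toFun := fun y => r y
      invFun := fun u => if h : u ∈ T then ⟨s u, (hsr u h).1⟩ else p
      source := {y | (y : Coord m) ∈ V}
      target := T
      map_source' := fun y hy => (hrs y y.2 hy).1
      map_target' := fun u hu => by
        simp only [hu, dif_pos, Set.mem_ofPred_eq]; exact (hsr u hu).2.1
      left_inv' := fun y hy => by
        have h := hrs y y.2 hy
        simp only [h.1, dif_pos]
        exact Subtype.ext h.2
      right_inv' := fun u hu => by
        simp only [hu, dif_pos]; exact (hsr u hu).2.2
      open_source := hV.preimage continuous_subtype_val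
      open_target := hT
      continuousOn_toFun := hr.continuousOn.comp continuous_subtype_val.continuousOn
        (fun y hy => hy)
      continuousOn_invFun := by
        rw [Topology.IsInducing.subtypeVal.continuousOn_iff]
        refine hs.continuousOn.congr fun u hu => ?_
        simp [hu] }
  refine ⟨e, ⟨hs.congr fun u hu => ?_, V, r, hV, hr, fun y hy => ⟨hy, rfl⟩⟩, rfl, fun _ => rfl⟩
  have hu' : u ∈ T := hu
  change ((if h : u ∈ T then (⟨s u, (hsr u h).1⟩ : S) else p : S) : Coord m) = s u
  simp [hu']

end Submanifold

/-- `diagDual` as a continuous linear map. -/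
def diagDualL {m : ℕ} (ε : Fin m → ℝ) : Coord m →L[ℝ] Coord m :=
  LinearMap.toContinuousLinearMap
    { toFun := diagDual ε
      map_add' := fun x y => by ext i; simp [diagDual, mul_add]
      map_smul' := fun c x => by ext i; simp [diagDual]; ring }

/-! ### Pull-backs of forms and rescaling along the null cone -/

section Metric

variable {n m k : ℕ} {M N P : Type*} [TopologicalSpace M] [ChartedSpace (Coord n) M]
  [TopologicalSpace N] [ChartedSpace (Coord m) N] [TopologicalSpace P] [ChartedSpace (Coord k) P]

theorem MetricField.pullback_pullback {Φ : M → N} {Ψ : N → P}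
    (hΨ : MDifferentiable (𝓡 m) (𝓡 k) Ψ) (hΦ : MDifferentiable (𝓡 n) (𝓡 m) Φ)
    (g : MetricField k P) :
    (MetricField.pullback Φ (MetricField.pullback Ψ g : MetricField m N) : MetricField n M) =
      MetricField.pullback (Ψ ∘ Φ) g := by
  funext x
  refine LinearMap.ext₂ fun v w => ?_
  simp only [MetricField.pullback, mfderiv_comp x (hΨ (Φ x)) (hΦ x)]
  rfl

theorem IsIsometric.trans {M N P : Type*} [TopologicalSpace M] [ChartedSpace (Coord n) M]
    [TopologicalSpace N] [ChartedSpace (Coord n) N] [TopologicalSpace P]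
    [ChartedSpace (Coord n) P] {g : MetricField n M} {h : MetricField n N} {k : MetricField n P}
    (h₁ : IsIsometric g h) (h₂ : IsIsometric h k) : IsIsometric g k := by
  obtain ⟨Φ, rfl⟩ := h₁
  obtain ⟨Ψ, rfl⟩ := h₂
  refine ⟨Φ.trans Ψ, ?_⟩
  rw [MetricField.pullback_pullback (Ψ.mdifferentiable (by simp)) (Φ.mdifferentiable (by simp))]
  rfl

/-- Reduces derivatives of vector-valued maps to calculus on `ℝⁿ`, where the product rule is
applied. -/
theorem mfderiv_eq_fderiv_chart {E : Type*} [NormedAddCommGroup E] [NormedSpace ℝ E]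
    {h : M → E} {x : M} (hh : MDifferentiableAt (𝓡 n) 𝓘(ℝ, E) h x) :
    mfderiv (𝓡 n) 𝓘(ℝ, E) h x = fderiv ℝ (h ∘ (chartAt (Coord n) x).symm) (chartAt (Coord n) x x) ∧
      DifferentiableAt ℝ (h ∘ (chartAt (Coord n) x).symm) (chartAt (Coord n) x x) := by
  constructor
  · rw [hh.mfderiv]
    simp only [writtenInExtChartAt, mfld_simps, fderivWithin_univ]
    rfl
  · have := hh.differentiableWithinAt_writtenInExtChartAt
    simp only [writtenInExtChartAt, mfld_simps, differentiableWithinAt_univ] at this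
    exact this

/-- The vector `h x` is null and, by differentiating the null condition, orthogonal to the image of
`dh`. Hence every term of the product rule that contains `h x` drops out. -/
theorem diagForm_fderiv_smul (ε : Fin m → ℝ) {l : Coord n → ℝ} {h : Coord n → Coord m}
    {x : Coord n} (hl : DifferentiableAt ℝ l x) (hh : DifferentiableAt ℝ h x)
    (hnull : ∀ z, diagForm ε (h z) (h z) = 0) (v w : Coord n) :
    diagForm ε (fderiv ℝ (fun z => l z • h z) x v) (fderiv ℝ (fun z => l z • h z) x w) =
      l x ^ 2 * diagForm ε (fderiv ℝ h x v) (fderiv ℝ h x w) := by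
  have ho : ∀ u, diagForm ε (h x) (fderiv ℝ h x u) = 0 := by
    intro u
    -- Written as a Euclidean inner product, the form can be differentiated by the product rule for
    -- inner products.
    have h1 : HasFDerivAt (fun z => ⟪diagDual ε (h z), h z⟫) _ x :=
      HasFDerivAt.inner ℝ (f := fun z => diagDual ε (h z))
        (f' := (diagDualL ε).comp (fderiv ℝ h x))
        ((diagDualL ε).hasFDerivAt.comp x hh.hasFDerivAt) hh.hasFDerivAt
    simp only [inner_diagDual, hnull] at h1
    have h2 := DFunLike.congr_fun (h1.unique (hasFDerivAt_const (0 : ℝ) x)) u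
    simp [fderivInnerCLM_apply, inner_diagDual] at h2
    have h3 : ⟪diagDualL ε (fderiv ℝ h x u), h x⟫ = diagForm ε (fderiv ℝ h x u) (h x) :=
      inner_diagDual _ _ _
    have h4 := diagForm_comm ε (h x) (fderiv ℝ h x u)
    rw [h3] at h2
    linarith
  have hd : ∀ u, fderiv ℝ (fun z => l z • h z) x u =
      l x • fderiv ℝ h x u + fderiv ℝ l x u • h x := by
    intro u
    rw [fderiv_fun_smul hl hh]
    simp
  have ho' : ∀ u, diagForm ε (fderiv ℝ h x u) (h x) = 0 := fun u => by rw [diagForm_comm, ho]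
  rw [hd, hd]
  simp only [map_add, map_smul, LinearMap.add_apply, LinearMap.smul_apply, smul_eq_mul, hnull, ho,
    ho']
  ring

/-- Rescaling a map with values in the null cone rescales the pulled back form. -/
theorem diagForm_mfderiv_smul (ε : Fin m → ℝ) {l : M → ℝ} {h : M → Coord m} {x : M}
    (hl : MDifferentiableAt (𝓡 n) 𝓘(ℝ, ℝ) l x) (hh : MDifferentiableAt (𝓡 n) (𝓡 m) h x)
    (hnull : ∀ z, diagForm ε (h z) (h z) = 0) (v w : TangentSpace (𝓡 n) x) :
    diagForm ε (mfderiv (𝓡 n) (𝓡 m) (fun z => l z • h z) x v)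
        (mfderiv (𝓡 n) (𝓡 m) (fun z => l z • h z) x w) =
      l x ^ 2 * diagForm ε (mfderiv (𝓡 n) (𝓡 m) h x v) (mfderiv (𝓡 n) (𝓡 m) h x w) := by
  have hlh : MDifferentiableAt (𝓡 n) (𝓡 m) (fun z => l z • h z) x := hl.smul hh
  rw [(mfderiv_eq_fderiv_chart hlh).1, (mfderiv_eq_fderiv_chart hh).1]
  have := diagForm_fderiv_smul ε (mfderiv_eq_fderiv_chart hl).2 (mfderiv_eq_fderiv_chart hh).2
    (fun z => hnull _) v w
  rw [Function.comp_apply,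
    (chartAt (Coord n) x).left_inv (mem_chart_source _ x)] at this
  exact this

end Metric

/-! ### Sections of the null cone and the associated spaces `X_f` -/

section ConeSection

/-- A section `σ` of the null cone over a manifold `Q`, together with smooth homogeneous
coordinates `(lam, π)` of the cone over it, `y = lam y • σ (π y)`, extended to an open conical
domain of the ambient space. -/
structure ConeSection (n : ℕ) (Q : Type*) [TopologicalSpace Q] [ChartedSpace (Coord n) Q] where
  σ : Q → Coord (n + 2)
  domain : Set (Coord (n + 2))
  π : Coord (n + 2) → Q
  lam : Coord (n + 2) → ℝ
  contMDiff_σ : ContMDiff (𝓡 n) (𝓡 (n + 2)) ∞ σ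
  isOpen_domain : IsOpen domain
  contMDiffOn_π : ContMDiffOn (𝓡 (n + 2)) (𝓡 n) ∞ π domain
  contDiffOn_lam : ContDiffOn ℝ ∞ lam domain
  smul_mem : ∀ t : ℝ, 0 < t → ∀ y ∈ domain, t • y ∈ domain
  π_smul : ∀ t : ℝ, 0 < t → ∀ y ∈ domain, π (t • y) = π y
  lam_smul : ∀ t : ℝ, 0 < t → ∀ y ∈ domain, lam (t • y) = t * lam y
  null_σ : ∀ s, ambientForm n (σ s) (σ s) = 0
  σ_mem : ∀ s, σ s ∈ domain
  π_σ : ∀ s, π (σ s) = s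
  lam_σ : ∀ s, lam (σ s) = 1
  lam_smul_σ : ∀ y ∈ domain, ambientForm n y y = 0 → lam y • σ (π y) = y

variable {n : ℕ} {Q : Type*} [TopologicalSpace Q] [ChartedSpace (Coord n) Q]

namespace ConeSection

/-- The homogeneous function whose `X_f` is the section rescaled by `e^φ`. -/
def homogeneousFunction (C : ConeSection n Q) {φ : Q → ℝ}
    (hφ : ContMDiff (𝓡 n) 𝓘(ℝ, ℝ) ∞ φ) : HomogeneousFunction n where
  domain := C.domain
  -- On the cone `y = lam y • σ (π y)`, so the value is `1` exactly when `y = e^φ σ` at the point `π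
  -- y`.
  toFun y := C.lam y * Real.exp (-φ (C.π y))
  isOpen_domain := C.isOpen_domain
  smul_mem := C.smul_mem
  contDiffOn := C.contDiffOn_lam.mul (Real.contDiff_exp.comp_contDiffOn
    (contMDiffOn_iff_contDiffOn.1 (hφ.comp_contMDiffOn C.contMDiffOn_π)).neg)
  map_smul t ht y hy := by rw [C.π_smul t ht y hy, C.lam_smul t ht y hy, mul_assoc]

theorem exp_smul_σ_mem (C : ConeSection n Q) {φ : Q → ℝ}
    (hφ : ContMDiff (𝓡 n) 𝓘(ℝ, ℝ) ∞ φ) (s : Q) :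
    Real.exp (φ s) • C.σ s ∈ (C.homogeneousFunction hφ).X := by
  refine ⟨?_, C.smul_mem _ (Real.exp_pos _) _ (C.σ_mem s), ?_⟩
  · simp [nullCone, C.null_σ]
  · change C.lam _ * Real.exp (-φ (C.π _)) = 1
    rw [C.π_smul _ (Real.exp_pos _) _ (C.σ_mem s), C.lam_smul _ (Real.exp_pos _) _ (C.σ_mem s),
      C.π_σ, C.lam_σ, mul_one, ← Real.exp_add, add_neg_cancel, Real.exp_zero]

theorem exp_smul_σ_π (C : ConeSection n Q) {φ : Q → ℝ}
    (hφ : ContMDiff (𝓡 n) 𝓘(ℝ, ℝ) ∞ φ) (y : (C.homogeneousFunction hφ).X) :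
    Real.exp (φ (C.π y)) • C.σ (C.π y) = (y : Coord (n + 2)) := by
  obtain ⟨y, hc, hd, h1⟩ := y
  have hc' : 1 / 2 * ambientForm n y y = 0 := hc
  have h1' : C.lam y * Real.exp (-φ (C.π y)) = 1 := h1
  have h2 : Real.exp (φ (C.π y)) = C.lam y := by
    rw [Real.exp_neg] at h1'
    field_simp at h1'
    exact h1'.symm
  simp only [h2]
  exact C.lam_smul_σ y hd (by linarith)

/-- The section rescaled by `e^φ` is a diffeomorphism onto `X_f`. -/
def diffeomorphX (C : ConeSection n Q) {φ : Q → ℝ}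
    (hφ : ContMDiff (𝓡 n) 𝓘(ℝ, ℝ) ∞ φ) :
    Diffeomorph (𝓡 n) (𝓡 n) Q (C.homogeneousFunction hφ).X ∞ where
  toFun s := ⟨Real.exp (φ s) • C.σ s, C.exp_smul_σ_mem hφ s⟩
  invFun y := C.π y
  left_inv s := by
    change C.π (Real.exp (φ s) • C.σ s) = s
    rw [C.π_smul _ (Real.exp_pos _) _ (C.σ_mem s), C.π_σ]
  right_inv y := Subtype.ext (C.exp_smul_σ_π hφ y)
  contMDiff_toFun s := contMDiffAt_submanifold (X_isSubmanifold _)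
    ((Real.contDiff_exp.contMDiff.comp hφ).smul C.contMDiff_σ s)
  contMDiff_invFun y :=
    (C.contMDiffOn_π.contMDiffAt (C.isOpen_domain.mem_nhds y.2.2.1)).comp y
      (contMDiff_subtype_val (X_isSubmanifold _) y)

/-- Followed by the inclusion of `X_f`, the diffeomorphism is `e^φ σ`; since `σ` is null, the
rescaling lemma extracts the factor `(e^φ)²`. -/
theorem isIsometric_X (C : ConeSection n Q) {φ : Q → ℝ}
    (hφ : ContMDiff (𝓡 n) 𝓘(ℝ, ℝ) ∞ φ) :
    IsIsometric (MetricField.rescale φ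
        (MetricField.pullback C.σ (constField (ambientForm n)) : MetricField n Q))
      (C.homogeneousFunction hφ).inducedMetric := by
  refine ⟨C.diffeomorphX hφ, ?_⟩
  unfold HomogeneousFunction.inducedMetric
  rw [MetricField.pullback_pullback
    ((contMDiff_subtype_val (X_isSubmanifold _)).mdifferentiable (by simp))
    ((C.diffeomorphX hφ).mdifferentiable (by simp))]
  funext s
  refine LinearMap.ext₂ fun v w => ?_
  have h := diagForm_mfderiv_smul (twoTimeSign (n + 2)) (x := s)
    ((Real.contDiff_exp.contMDiff.comp hφ).mdifferentiable (by simp) s)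
    (C.contMDiff_σ.mdifferentiable (by simp) s) C.null_σ v w
  refine Eq.trans ?_ h.symm
  rw [Function.comp_apply, ← Real.exp_nat_mul]
  rfl

/-- A globally conformal rescaling of `h = σ^* η` is some `X_f`. -/
theorem exists_isIsometric (C : ConeSection n Q) {h : MetricField n Q}
    (hC : MetricField.pullback C.σ (constField (ambientForm n)) = h)
    {M : Type*} [TopologicalSpace M] [ChartedSpace (Coord n) M] {g : MetricField n M}
    (hg : IsGloballyConformalTo g h) :
    ∃ f : HomogeneousFunction n, IsIsometric g f.inducedMetric := by
  obtain ⟨φ, hφ, hiso⟩ := hg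
  subst hC
  exact ⟨C.homogeneousFunction hφ, hiso.trans (C.isIsometric_X hφ)⟩

end ConeSection

end ConeSection

/-! ### Null coordinates on the ambient space -/

section NullFrame

/-- Null coordinates `(a, b, w)` in which the ambient form is `2 a b` plus the Minkowski form. -/
structure NullFrame (n : ℕ) where
  L : Coord (n + 2) ≃L[ℝ] ℝ × ℝ × Coord n
  form_eq : ∀ y z, ambientForm n y z = (L y).1 * (L z).2.1 + (L y).2.1 * (L z).1 +
    diagForm (lorentzSign n) (L y).2.2 (L z).2.2

variable {n : ℕ}

/-- The standard null coordinates. -/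
def NullFrame.standard (hn : 1 ≤ n) : NullFrame n where
  L := LinearEquiv.toContinuousLinearEquiv
    -- The product `2 a b` is the difference of squares of the last two coordinates, one a time and
    -- the other spatial.
    { toFun := fun y => (y (Fin.last _) + y (Fin.last _).castSucc,
        (y (Fin.last _) - y (Fin.last _).castSucc) / 2,
        WithLp.toLp 2 fun i => y i.castSucc.castSucc)
      map_add' := fun y z => by
        ext <;> simp <;> ring
      map_smul' := fun c y => by
        ext <;> simp <;> ring
      invFun := fun p => WithLp.toLp 2
        (Fin.snoc (α := fun _ => ℝ) (Fin.snoc (α := fun _ => ℝ) p.2.2 (p.1 / 2 - p.2.1))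
          (p.1 / 2 + p.2.1))
      left_inv := fun y => by
        ext i
        refine Fin.lastCases ?_ (fun i => ?_) i
        · simp; ring
        · refine Fin.lastCases ?_ (fun i => ?_) i
          · simp; ring
          · simp
      right_inv := fun p => by
        ext <;> simp }
  form_eq y z := by
    have h1 : ∀ i : Fin n, twoTimeSign (n + 2) i.castSucc.castSucc = lorentzSign n i := by
      intro i
      have := i.2
      simp [twoTimeSign, lorentzSign, show i.val ≠ n + 1 by omega]
    -- This needs `1 ≤ n`: for `n = 0` this index is `0`, a time coordinate.
    have h2 : twoTimeSign (n + 2) (Fin.last n).castSucc = -1 := by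
      simp [twoTimeSign]; omega
    have h3 : twoTimeSign (n + 2) (Fin.last (n + 1)) = 1 := by
      simp [twoTimeSign]
    simp only [ambientForm, diagForm_apply, Fin.sum_univ_castSucc, h1, h2, h3]
    simp
    ring

/-- Exchanging the two null coordinates. -/
def NullFrame.swap (F : NullFrame n) : NullFrame n where
  L := F.L.trans
    { toFun := fun p => (p.2.1, p.1, p.2.2)
      map_add' := fun _ _ => rfl
      map_smul' := fun _ _ => rfl
      invFun := fun p => (p.2.1, p.1, p.2.2)
      left_inv := fun _ => rfl
      right_inv := fun _ => rfl
      continuous_toFun := by fun_prop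
      continuous_invFun := by fun_prop }
  form_eq y z := by
    rw [F.form_eq]
    simp
    ring

/-- Precomposing with a linear isometry. -/
def NullFrame.comp (F : NullFrame n) (A : Coord (n + 2) ≃L[ℝ] Coord (n + 2))
    (hA : ∀ y z, ambientForm n (A y) (A z) = ambientForm n y z) : NullFrame n where
  L := A.trans F.L
  form_eq y z := by rw [← hA, F.form_eq]; rfl

/-- The linear isometry exchanging the two time coordinates. -/
def swapTimes (n : ℕ) : Coord (n + 2) ≃L[ℝ] Coord (n + 2) :=
  (LinearIsometryEquiv.piLpCongrLeft 2 ℝ ℝ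
    (Equiv.swap (0 : Fin (n + 2)) (Fin.last _))).toContinuousLinearEquiv

theorem swapTimes_apply (y : Coord (n + 2)) (i : Fin (n + 2)) :
    swapTimes n y i = y (Equiv.swap 0 (Fin.last _) i) := by
  simp [swapTimes, Equiv.piCongrLeft'_apply]

theorem ambientForm_swapTimes (y z : Coord (n + 2)) :
    ambientForm n (swapTimes n y) (swapTimes n z) = ambientForm n y z := by
  simp only [ambientForm, diagForm_apply, swapTimes_apply]
  refine Fintype.sum_equiv (Equiv.swap 0 (Fin.last _)) _ _ fun i => ?_
  congr 2
  rcases eq_or_ne i 0 with rfl | h0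
  · simp [twoTimeSign]
  · rcases eq_or_ne i (Fin.last _) with rfl | h1
    · simp [twoTimeSign]
    · rw [Equiv.swap_apply_of_ne_of_ne h0 h1]

/-- Both `y ↦ -y` and the exchange of `a` and `b` preserve the form, so either null coordinate can
be moved to first place and made positive. -/
theorem NullFrame.exists_pos_of_ne_zero (F : NullFrame n) {y : Coord (n + 2)}
    (h : (F.L y).1 ≠ 0 ∨ (F.L y).2.1 ≠ 0) : ∃ G : NullFrame n, 0 < (G.L y).1 := by
  have key : ∀ G : NullFrame n, (G.L y).1 ≠ 0 → ∃ G : NullFrame n, 0 < (G.L y).1 := by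
    intro G hG
    rcases lt_or_gt_of_ne hG with h | h
    · refine ⟨G.comp (ContinuousLinearEquiv.neg ℝ) fun y z => by simp, ?_⟩
      simpa [NullFrame.comp] using h
    · exact ⟨G, h⟩
  rcases h with h | h
  · exact key F h
  · exact key F.swap h

/-- If no frame works, the standard null coordinates of `y` vanish, and so do those of `y` with its
times exchanged. Both time coordinates of `y` are then zero, and `η` is negative definite on such
vectors, so a null `y` would be zero. -/
theorem NullFrame.exists_pos (hn : 1 ≤ n) {y : Coord (n + 2)} (hy : y ≠ 0)
    (hnull : ambientForm n y y = 0) : ∃ F : NullFrame n, 0 < (F.L y).1 := by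
  by_contra hcon
  have h1 := mt (NullFrame.standard hn).exists_pos_of_ne_zero hcon
  have h2 := mt ((NullFrame.standard hn).comp (swapTimes n)
    ambientForm_swapTimes).exists_pos_of_ne_zero hcon
  push Not at h1 h2
  obtain ⟨h1, h1'⟩ := h1
  obtain ⟨h2, h2'⟩ := h2
  change y (Fin.last _) + y (Fin.last _).castSucc = 0 at h1
  change (y (Fin.last _) - y (Fin.last _).castSucc) / 2 = 0 at h1'
  change swapTimes n y (Fin.last _) + swapTimes n y (Fin.last _).castSucc = 0 at h2
  change (swapTimes n y (Fin.last _) - swapTimes n y (Fin.last _).castSucc) / 2 = 0 at h2'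
  have hl : y (Fin.last _) = 0 := by linarith
  have h0 : y 0 = 0 := by
    have : swapTimes n y (Fin.last _) = 0 := by linarith
    rwa [swapTimes_apply, Equiv.swap_apply_right] at this
  have hterm : ∀ i, twoTimeSign (n + 2) i * y i * y i = -(y i ^ 2) := by
    intro i
    unfold twoTimeSign
    split_ifs with h
    · rcases h with h | h
      · rw [show i = 0 from Fin.ext h, h0]; ring
      · rw [show i = Fin.last _ from Fin.ext (by simpa using h), hl]; ring
    · ring
  simp only [ambientForm, diagForm_apply, hterm, Finset.sum_neg_distrib, neg_eq_zero] at hnull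
  rw [Finset.sum_eq_zero_iff_of_nonneg fun i _ => sq_nonneg _] at hnull
  exact hy (by ext i; simpa using hnull i (Finset.mem_univ i))

end NullFrame

/-! ### The paraboloid model of Minkowski space and conformal flatness of `X_f` -/

section NullFrame

variable {n : ℕ}

namespace NullFrame

/-- The parametrization of the null cone normalized by `a = 1`. -/
def param (F : NullFrame n) (x : Coord n) : Coord (n + 2) :=
  F.L.symm (1, -(diagForm (lorentzSign n) x x / 2), x)

/-- The affine coordinates `w / a` of the null cone. -/
def coord (F : NullFrame n) (y : Coord (n + 2)) : Coord n :=
  (F.L y).1⁻¹ • (F.L y).2.2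

theorem contDiff_param (F : NullFrame n) : ContDiff ℝ ∞ F.param :=
  F.L.symm.contDiff.comp (contDiff_const.prodMk
    (((contDiff_diagForm _).div_const 2).neg.prodMk contDiff_id))

theorem contDiff_fst (F : NullFrame n) : ContDiff ℝ ∞ fun y => (F.L y).1 :=
  _root_.contDiff_fst.comp F.L.contDiff

theorem isOpen_pos (F : NullFrame n) : IsOpen {y | 0 < (F.L y).1} :=
  isOpen_lt continuous_const F.contDiff_fst.continuous

theorem contDiffOn_coord (F : NullFrame n) : ContDiffOn ℝ ∞ F.coord {y | 0 < (F.L y).1} :=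
  (F.contDiff_fst.contDiffOn.inv fun _ hy => ne_of_gt hy).smul
    (contDiff_snd.comp (contDiff_snd.comp F.L.contDiff)).contDiffOn

theorem ambientForm_param (F : NullFrame n) (x : Coord n) :
    ambientForm n (F.param x) (F.param x) = 0 := by
  rw [F.form_eq]
  simp [param]
  ring

theorem fst_param (F : NullFrame n) (x : Coord n) : (F.L (F.param x)).1 = 1 := by
  simp [param]

theorem coord_param (F : NullFrame n) (x : Coord n) : F.coord (F.param x) = x := by
  simp [param, coord]

theorem coord_smul (F : NullFrame n) {t : ℝ} (ht : 0 < t) (y : Coord (n + 2)) :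
    F.coord (t • y) = F.coord y := by
  simp only [coord, map_smul, Prod.smul_fst, Prod.smul_snd, smul_eq_mul, smul_smul, mul_inv]
  congr 1
  field_simp

/-- The null condition `2 a b + ⟨w, w⟩ = 0` determines `b` from `a` and `w` when `a ≠ 0`. -/
theorem smul_param_coord (F : NullFrame n) {y : Coord (n + 2)} (hy : 0 < (F.L y).1)
    (hnull : ambientForm n y y = 0) : (F.L y).1 • F.param (F.coord y) = y := by
  rw [F.form_eq] at hnull
  apply F.L.injective
  simp only [param, coord, map_smul, ContinuousLinearEquiv.apply_symm_apply, smul_eq_mul,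
    LinearMap.smul_apply]
  have ha := hy.ne'
  refine Prod.ext ?_ (Prod.ext ?_ ?_)
  · simp
  · simp only [Prod.smul_snd, Prod.smul_fst, smul_eq_mul]
    field_simp
    linarith
  · simp [smul_smul, ha]

/-- The coordinate `a` is constant along the paraboloid, so the cross term `2 a b` contributes
nothing on tangent vectors, whatever the derivative of `b`. -/
theorem ambientForm_fderiv_param (F : NullFrame n) (x v w : Coord n) :
    ambientForm n (fderiv ℝ F.param x v) (fderiv ℝ F.param x w) =
      diagForm (lorentzSign n) v w := by
  have h1 : DifferentiableAt ℝ
      (fun x : Coord n => -(diagForm (lorentzSign n) x x / 2)) x :=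
    (((contDiff_diagForm _).div_const 2).neg.differentiable (by simp)) x
  have h2 : HasFDerivAt F.param _ x := F.L.symm.hasFDerivAt.comp x
    ((hasFDerivAt_const (1 : ℝ) x).prodMk (h1.hasFDerivAt.prodMk (hasFDerivAt_id x)))
  rw [h2.fderiv, F.form_eq]
  simp

/-- Minkowski space as a section of the null cone. -/
def coneSection (F : NullFrame n) : ConeSection n (Coord n) where
  σ := F.param
  domain := {y | 0 < (F.L y).1}
  π := F.coord
  lam y := (F.L y).1
  contMDiff_σ := F.contDiff_param.contMDiff
  isOpen_domain := F.isOpen_pos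
  contMDiffOn_π := F.contDiffOn_coord.contMDiffOn
  contDiffOn_lam := F.contDiff_fst.contDiffOn
  smul_mem t ht y hy := by
    have : 0 < t * (F.L y).1 := mul_pos ht hy
    simpa using this
  π_smul t ht y _ := F.coord_smul ht y
  lam_smul t ht y _ := by simp
  null_σ := F.ambientForm_param
  σ_mem s := by simp [F.fst_param]
  π_σ := F.coord_param
  lam_σ := F.fst_param
  lam_smul_σ _ hy hc := F.smul_param_coord hy hc

theorem pullback_param (F : NullFrame n) :
    MetricField.pullback F.param (constField (ambientForm n)) = minkowskiMetric n := by
  funext x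
  refine LinearMap.ext₂ fun v w => ?_
  have h := F.ambientForm_fderiv_param x v w
  rw [← mfderiv_eq_fderiv] at h
  exact h

end NullFrame

theorem HomogeneousFunction.isConformallyFlat (hn : 1 ≤ n) (f : HomogeneousFunction n) :
    IsConformallyFlat f.inducedMetric := by
  rintro ⟨y₀, hy₀⟩
  have hcone : ∀ y ∈ f.X, ambientForm n y y = 0 := by
    intro y hy
    have h : 1 / 2 * ambientForm n y y = 0 := hy.1
    linarith
  -- At the origin homogeneity would give `f 0 = 2 f 0`, against `f 0 = 1`.
  have hy0 : y₀ ≠ 0 := by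
    rintro rfl
    have h2 := f.map_smul 2 (by norm_num) 0 hy₀.2.1
    rw [smul_zero, hy₀.2.2] at h2
    norm_num at h2
  obtain ⟨F, hF⟩ := NullFrame.exists_pos hn hy0 (hcone _ hy₀)
  obtain ⟨e, he, hsource, heq⟩ := exists_chart_eq (S := f.X) (n := n) ⟨y₀, hy₀⟩
    (V := {y | 0 < (F.L y).1}) (r := F.coord)
    (T := {x | F.param x ∈ f.domain ∧ 0 < f.toFun (F.param x)})
    -- The inverse chart slides the paraboloid point along its ray until `f = 1`, which is possible
    -- where `f` is positive.
    (s := fun x => (f.toFun (F.param x))⁻¹ • F.param x) F.isOpen_pos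
    ((f.contDiffOn.continuousOn.isOpen_inter_preimage f.isOpen_domain isOpen_Ioi).preimage
      F.contDiff_param.continuous)
    F.contDiffOn_coord
    (((f.contDiffOn.comp F.contDiff_param.contDiffOn fun x hx => hx.1).inv
      fun x hx => ne_of_gt hx.2).smul F.contDiff_param.contDiffOn)
    (by
      intro y hy hyV
      have hpos : 0 < (F.L y).1 := hyV
      have hparam : F.param (F.coord y) = (F.L y).1⁻¹ • y := by
        rw [eq_inv_smul_iff₀ hpos.ne', F.smul_param_coord hpos (hcone y hy)]
      have hf : f.toFun ((F.L y).1⁻¹ • y) = (F.L y).1⁻¹ := by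
        rw [f.map_smul _ (inv_pos.2 hpos) _ hy.2.1, hy.2.2, mul_one]
      refine ⟨⟨?_, ?_⟩, ?_⟩
      · rw [hparam]; exact f.smul_mem _ (inv_pos.2 hpos) _ hy.2.1
      · rw [hparam, hf]; exact inv_pos.2 hpos
      · simp only [hparam, hf, inv_inv, smul_smul, mul_inv_cancel₀ hpos.ne', one_smul])
    (by
      rintro x ⟨hx, hx0⟩
      have hi := inv_pos.2 hx0
      refine ⟨⟨?_, f.smul_mem _ hi _ hx, ?_⟩, ?_, ?_⟩
      · simp [nullCone, F.ambientForm_param]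
      · rw [f.map_smul _ hi _ hx, inv_mul_cancel₀ hx0.ne']
      · simpa [F.fst_param] using hx0
      · rw [F.coord_smul hi, F.coord_param])
  have hmax : e ∈ IsManifold.maximalAtlas (𝓡 n) ∞ f.X := IsManifold.subset_maximalAtlas he
  have hval := contMDiff_subtype_val (X_isSubmanifold f)
  have hlam : ContMDiff (𝓡 n) 𝓘(ℝ, ℝ) ∞ fun y : f.X => (F.L (y : Coord (n + 2))).1 :=
    F.contDiff_fst.contMDiff.comp hval
  refine ⟨e, hmax, by rw [hsource]; exact hF,
    -- Chosen so that `e^(2ψ) = a²`.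
    fun y => Real.log (F.L (y : Coord (n + 2))).1, ?_, ?_⟩
  · intro y hy
    rw [hsource] at hy
    have h1 : ContMDiffAt 𝓘(ℝ, ℝ) 𝓘(ℝ, ℝ) ∞ Real.log (F.L (y : Coord (n + 2))).1 :=
      (Real.contDiffAt_log.2 (ne_of_gt hy)).contMDiffAt
    exact (h1.comp y (hlam y)).contMDiffWithinAt
  · intro y hy
    have hpos : 0 < (F.L (y : Coord (n + 2))).1 := by rw [hsource] at hy; exact hy
    have hemd : MDifferentiableAt (𝓡 n) (𝓡 n) e y :=
      ((contMDiffOn_of_mem_maximalAtlas hmax).contMDiffAt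
        (e.open_source.mem_nhds hy)).mdifferentiableAt (by simp)
    have hpmd : MDifferentiableAt (𝓡 n) (𝓡 (n + 2)) F.param (e y) :=
      (F.contDiff_param.contMDiff (e y)).mdifferentiableAt (by simp)
    -- The inclusion is locally `a` times the paraboloid over the chart, which is what the rescaling
    -- lemma needs.
    have hloc : (Subtype.val : f.X → Coord (n + 2)) =ᶠ[nhds y]
        fun z : f.X => (F.L (z : Coord (n + 2))).1 • (F.param ∘ e) z := by
      filter_upwards [e.open_source.mem_nhds hy] with z hz
      rw [hsource] at hz
      rw [Function.comp_apply, heq, F.smul_param_coord hz (hcone z z.2)]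
    refine LinearMap.ext₂ fun v w => ?_
    have h := diagForm_mfderiv_smul (twoTimeSign (n + 2))
      ((hlam y).mdifferentiableAt (by simp)) (hpmd.comp y hemd)
      (fun z => F.ambientForm_param (e z)) v w
    rw [← hloc.mfderiv_eq, mfderiv_comp y hpmd hemd, mfderiv_eq_fderiv] at h
    refine h.trans ?_
    have h2 := F.ambientForm_fderiv_param (e y) (mfderiv (𝓡 n) (𝓡 n) e y v)
      (mfderiv (𝓡 n) (𝓡 n) e y w)
    have h3 : Real.exp (2 * Real.log (F.L (y : Coord (n + 2))).1) =
        (F.L (y : Coord (n + 2))).1 ^ 2 := by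
      rw [two_mul, Real.exp_add, Real.exp_log hpos, sq]
    change _ = Real.exp (2 * Real.log (F.L (y : Coord (n + 2))).1) *
      diagForm (lorentzSign n) (mfderiv (𝓡 n) (𝓡 n) e y v) (mfderiv (𝓡 n) (𝓡 n) e y w)
    rw [h3, ← h2]
    rfl

end NullFrame

/-! ### De Sitter and anti-de Sitter spaces as slices of the null cone -/

section Quadric

variable {n : ℕ}

/-- The vector with `p`-th coordinate `l` and remaining coordinates `x`. -/
def insertCoord (p : Fin (n + 2)) (l : ℝ) (x : Coord (n + 1)) : Coord (n + 2) :=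
  WithLp.toLp 2 (p.insertNth (α := fun _ => ℝ) l x)

/-- The vector obtained by omitting the `p`-th coordinate. -/
def omitCoord (p : Fin (n + 2)) (y : Coord (n + 2)) : Coord (n + 1) :=
  WithLp.toLp 2 fun i => y (p.succAbove i)

theorem insertCoord_same (p : Fin (n + 2)) (l : ℝ) (x : Coord (n + 1)) :
    insertCoord p l x p = l := by
  simp [insertCoord]

theorem omitCoord_insertCoord (p : Fin (n + 2)) (l : ℝ) (x : Coord (n + 1)) :
    omitCoord p (insertCoord p l x) = x := by
  ext i; simp [insertCoord, omitCoord]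

theorem insertCoord_omitCoord (p : Fin (n + 2)) (y : Coord (n + 2)) :
    insertCoord p (y p) (omitCoord p y) = y := by
  ext i
  refine Fin.succAboveCases p ?_ (fun i => ?_) i <;> simp [insertCoord, omitCoord]

theorem smul_insertCoord (p : Fin (n + 2)) (c l : ℝ) (x : Coord (n + 1)) :
    c • insertCoord p l x = insertCoord p (c * l) (c • x) := by
  ext i
  refine Fin.succAboveCases p ?_ (fun i => ?_) i <;> simp [insertCoord]

theorem omitCoord_smul (p : Fin (n + 2)) (c : ℝ) (y : Coord (n + 2)) :
    omitCoord p (c • y) = c • omitCoord p y := by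
  ext i; simp [omitCoord]

theorem contDiff_omitCoord (p : Fin (n + 2)) : ContDiff ℝ ∞ (omitCoord p) := by
  rw [contDiff_euclidean]
  intro i
  simp only [omitCoord]
  fun_prop

/-- The inclusion of the hyperplane of vectors with vanishing `p`-th coordinate. -/
def insertZero (p : Fin (n + 2)) : Coord (n + 1) →L[ℝ] Coord (n + 2) :=
  LinearMap.toContinuousLinearMap
    { toFun := insertCoord p 0
      map_add' := fun x y => by
        ext i
        refine Fin.succAboveCases p ?_ (fun i => ?_) i <;> simp [insertCoord]
      map_smul' := fun c x => by rw [smul_insertCoord]; simp }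

theorem insertZero_apply (p : Fin (n + 2)) (x : Coord (n + 1)) :
    insertZero p x = insertCoord p 0 x := rfl

/-- Exhibits the insertion as an affine map, which gives its smoothness and its derivative. -/
theorem insertCoord_eq (p : Fin (n + 2)) (l : ℝ) :
    insertCoord p l = fun x : Coord (n + 1) => insertCoord p l 0 + insertZero p x := by
  funext x
  rw [insertZero_apply]
  ext i
  refine Fin.succAboveCases p ?_ (fun i => ?_) i <;> simp [insertCoord]

theorem ambientForm_eq_omitCoord {p : Fin (n + 2)} {ε : Fin (n + 1) → ℝ}
    (hε : ∀ i, twoTimeSign (n + 2) (p.succAbove i) = ε i) (y z : Coord (n + 2)) :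
    ambientForm n y z = twoTimeSign (n + 2) p * y p * z p +
      diagForm ε (omitCoord p y) (omitCoord p z) := by
  simp only [ambientForm, diagForm_apply, Fin.sum_univ_succAbove _ p, hε]
  rfl

instance (ε : Fin (n + 1) → ℝ) (a : ℝ) : ChartedSpace (Coord n) (quadric ε a) :=
  submanifoldChartedSpace (quadric_isSubmanifold ε a)

open Classical in
/-- The radial retraction onto a quadric of the cone over it. -/
def quadricRetraction (ε : Fin (n + 1) → ℝ) (a : ℝ) (s₀ : quadric ε a)
    (x : Coord (n + 1)) : quadric ε a :=
  if h : 0 < a * diagForm ε x x then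
    ⟨(Real.sqrt (a * diagForm ε x x))⁻¹ • x, by
      change a * diagForm ε _ _ = 1
      simp only [map_smul, LinearMap.smul_apply, smul_eq_mul]
      have h0 := Real.sqrt_pos.2 h
      have h1 := Real.sq_sqrt h.le
      field_simp
      exact h1.symm⟩
  -- An arbitrary value outside the cone over the quadric, never reached on the domain used below;
  -- it is why the quadric must be nonempty.
  else s₀

theorem coe_quadricRetraction {ε : Fin (n + 1) → ℝ} {a : ℝ} (s₀ : quadric ε a)
    {x : Coord (n + 1)} (h : 0 < a * diagForm ε x x) :
    (quadricRetraction ε a s₀ x : Coord (n + 1)) = (Real.sqrt (a * diagForm ε x x))⁻¹ • x := by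
  rw [quadricRetraction, dif_pos h]

theorem contMDiffOn_quadricRetraction (ε : Fin (n + 1) → ℝ) (a : ℝ) (s₀ : quadric ε a) :
    ContMDiffOn (𝓡 (n + 1)) (𝓡 n) ∞ (quadricRetraction ε a s₀)
      {x | 0 < a * diagForm ε x x} := by
  have hform : ContDiff ℝ ∞ fun x : Coord (n + 1) => a * diagForm ε x x :=
    contDiff_const.mul (contDiff_diagForm ε)
  have hopen : IsOpen {x : Coord (n + 1) | 0 < a * diagForm ε x x} :=
    isOpen_lt continuous_const hform.continuous
  intro x hx
  refine (contMDiffAt_submanifold (quadric_isSubmanifold ε a) ?_).contMDiffWithinAt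
  have hx' : 0 < a * diagForm ε x x := hx
  have h1 : ContDiffAt ℝ ∞ (fun x : Coord (n + 1) =>
      (Real.sqrt (a * diagForm ε x x))⁻¹ • x) x :=
    ((hform.contDiffAt.sqrt hx'.ne').inv (Real.sqrt_pos.2 hx').ne').smul contDiffAt_id
  refine h1.contMDiffAt.congr_of_eventuallyEq ?_
  filter_upwards [hopen.mem_nhds hx] with z hz
  exact coe_quadricRetraction s₀ hz

/-- The quadric `⟨x, x⟩ = -c / H²` as a section of the null cone `c l² + ⟨x, x⟩ = 0`. -/
def quadricConeSection {p : Fin (n + 2)} {ε : Fin (n + 1) → ℝ}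
    (hε : ∀ i, twoTimeSign (n + 2) (p.succAbove i) = ε i)
    {a H : ℝ} (hH : 0 < H) (ha : a * twoTimeSign (n + 2) p = -H ^ 2)
    (s₀ : quadric ε a) : ConeSection n (quadric ε a) where
  -- By `ha`, the inserted coordinate contributes `-1/a` to the form, which cancels `⟨s, s⟩ = 1/a`.
  σ s := insertCoord p H⁻¹ s
  -- On the cone the second condition follows from the first; it is imposed to make the retraction
  -- smooth on an open ambient set.
  domain := {y | 0 < y p ∧ 0 < a * diagForm ε (omitCoord p y) (omitCoord p y)}
  π y := quadricRetraction ε a s₀ (omitCoord p y)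
  lam y := H * y p
  contMDiff_σ := by
    rw [insertCoord_eq]
    exact (contDiff_const.add (insertZero p).contDiff).contMDiff.comp
      (contMDiff_subtype_val (quadric_isSubmanifold ε a))
  isOpen_domain := by
    have h1 : Continuous fun y : Coord (n + 2) =>
        a * diagForm ε (omitCoord p y) (omitCoord p y) :=
      continuous_const.mul ((contDiff_diagForm ε).continuous.comp (contDiff_omitCoord p).continuous)
    exact (isOpen_lt continuous_const (by fun_prop : Continuous fun y : Coord (n + 2) => y p)).inter
      (isOpen_lt continuous_const h1)
  contMDiffOn_π := (contMDiffOn_quadricRetraction ε a s₀).comp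
    (contDiff_omitCoord p).contMDiff.contMDiffOn fun _ hy => hy.2
  contDiffOn_lam := by fun_prop
  smul_mem t ht y hy := by
    refine ⟨mul_pos ht hy.1, ?_⟩
    have := mul_pos (mul_pos ht ht) hy.2
    simp only [omitCoord_smul, map_smul, LinearMap.smul_apply, smul_eq_mul]
    linarith
  π_smul t ht y hy := by
    have h2 : a * diagForm ε (t • omitCoord p y) (t • omitCoord p y) =
        t ^ 2 * (a * diagForm ε (omitCoord p y) (omitCoord p y)) := by
      simp only [map_smul, LinearMap.smul_apply, smul_eq_mul]; ring
    have h3 : 0 < a * diagForm ε (t • omitCoord p y) (t • omitCoord p y) := by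
      rw [h2]; exact mul_pos (pow_pos ht 2) hy.2
    rw [omitCoord_smul]
    refine Subtype.ext ?_
    rw [coe_quadricRetraction s₀ h3, coe_quadricRetraction s₀ hy.2, h2,
      Real.sqrt_mul (sq_nonneg t), Real.sqrt_sq ht.le, smul_smul]
    congr 1
    field_simp
  lam_smul t ht y _ := by simp; ring
  null_σ s := by
    have hs : a * diagForm ε (s : Coord (n + 1)) s = 1 := s.2
    have ha0 : a ≠ 0 := by rintro rfl; simp at hs
    rw [ambientForm_eq_omitCoord hε, omitCoord_insertCoord, insertCoord_same]
    refine mul_left_cancel₀ ha0 ?_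
    rw [mul_add, hs, mul_zero]
    field_simp
    linarith
  σ_mem s := by
    have hs : a * diagForm ε (s : Coord (n + 1)) s = 1 := s.2
    simp [omitCoord_insertCoord, insertCoord_same, hs, hH]
  π_σ s := by
    have hs : a * diagForm ε (s : Coord (n + 1)) s = 1 := s.2
    rw [omitCoord_insertCoord]
    refine Subtype.ext ?_
    rw [coe_quadricRetraction s₀ (by rw [hs]; norm_num), hs]
    simp
  lam_σ s := by rw [insertCoord_same]; field_simp
  lam_smul_σ y hy hc := by
    rw [ambientForm_eq_omitCoord hε] at hc
    -- On the cone the retraction therefore divides by exactly `lam y = H * y p`.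
    have h1 : a * diagForm ε (omitCoord p y) (omitCoord p y) = (H * y p) ^ 2 := by
      linear_combination a * hc - (y p) ^ 2 * ha
    have h2 : 0 < H * y p := mul_pos hH hy.1
    rw [coe_quadricRetraction s₀ hy.2, h1, Real.sqrt_sq h2.le, smul_insertCoord, smul_smul,
      mul_inv_cancel₀ h2.ne', one_smul]
    conv_rhs => rw [← insertCoord_omitCoord p y]
    congr 1
    field_simp

/-- The inserted coordinate is constant, so tangent vectors have no component along it. -/
theorem pullback_insertCoord {p : Fin (n + 2)} {ε : Fin (n + 1) → ℝ}
    (hε : ∀ i, twoTimeSign (n + 2) (p.succAbove i) = ε i) (a l : ℝ) :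
    (MetricField.pullback (fun s : quadric ε a => insertCoord p l s)
        (constField (ambientForm n)) : MetricField n (quadric ε a)) =
      MetricField.pullback Subtype.val (constField (diagForm ε)) := by
  have hval := (contMDiff_subtype_val (quadric_isSubmanifold ε a)).mdifferentiable (by simp)
  funext s
  refine LinearMap.ext₂ fun v w => ?_
  have hins : HasFDerivAt (insertCoord p l) (insertZero p) (s : Coord (n + 1)) := by
    rw [insertCoord_eq]
    exact (insertZero p).hasFDerivAt.const_add _
  have hd : mfderiv (𝓡 n) (𝓡 (n + 2)) (fun s : quadric ε a => insertCoord p l s) s =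
      (insertZero p).comp (mfderiv (𝓡 n) (𝓡 (n + 1)) Subtype.val s) := by
    have h := mfderiv_comp s hins.differentiableAt.mdifferentiableAt (hval s)
    rw [mfderiv_eq_fderiv, hins.fderiv] at h
    exact h
  have h : ∀ x y : Coord (n + 1),
      ambientForm n (insertZero p x) (insertZero p y) = diagForm ε x y := by
    intro x y
    rw [ambientForm_eq_omitCoord hε, insertZero_apply, insertZero_apply, omitCoord_insertCoord,
      omitCoord_insertCoord, insertCoord_same]
    simp
  change ambientForm n (mfderiv (𝓡 n) (𝓡 (n + 2)) (fun s : quadric ε a => insertCoord p l s) s v)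
    (mfderiv (𝓡 n) (𝓡 (n + 2)) (fun s : quadric ε a => insertCoord p l s) s w) = _
  rw [hd]
  exact h _ _

theorem nonempty_quadric {ε : Fin (n + 1) → ℝ} {a : ℝ} (i : Fin (n + 1)) (h : 0 < a * ε i) :
    Nonempty (quadric ε a) := by
  refine ⟨⟨EuclideanSpace.single i (Real.sqrt (a * ε i))⁻¹, ?_⟩⟩
  have h0 := Real.sqrt_pos.2 h
  have h1 := Real.sq_sqrt h.le
  change a * diagForm ε _ _ = 1
  rw [diagForm_apply, Finset.sum_eq_single i (fun j _ hj => by simp [hj]) (by simp)]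
  simp only [PiLp.single_apply, if_true]
  field_simp
  exact h1.symm

/-- A globally conformal rescaling of a nonempty quadric `⟨x, x⟩ = -c / H²` is some `X_f`. -/
theorem exists_isIsometric_of_quadric {p : Fin (n + 2)} {ε : Fin (n + 1) → ℝ}
    (hε : ∀ i, twoTimeSign (n + 2) (p.succAbove i) = ε i)
    {a H : ℝ} (hH : 0 < H) (ha : a * twoTimeSign (n + 2) p = -H ^ 2)
    (i : Fin (n + 1)) (hi : 0 < a * ε i)
    {M : Type*} [TopologicalSpace M] [ChartedSpace (Coord n) M] {g : MetricField n M}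
    (hg : IsGloballyConformalTo g
      (MetricField.pullback Subtype.val (constField (diagForm ε)) : MetricField n (quadric ε a))) :
    ∃ f : HomogeneousFunction n, IsIsometric g f.inducedMetric :=
  let ⟨s₀⟩ := nonempty_quadric i hi
  (quadricConeSection hε hH ha s₀).exists_isIsometric (pullback_insertCoord hε a _) hg

end Quadric

/-! ### The three model spaces -/

theorem IsGloballyConformallyAdSM.exists_isIsometric {n : ℕ} (hn : 1 ≤ n) {M : Type*}
    [TopologicalSpace M] [ChartedSpace (Coord n) M] {g : MetricField n M}
    (hg : IsGloballyConformallyAdSM g) :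
    ∃ f : HomogeneousFunction n, IsIsometric g f.inducedMetric := by
  rcases hg with ⟨H, hH, hg⟩ | hg | ⟨H, hH, hg⟩
  -- De Sitter space: fixing the last time leaves the Lorentzian form. The last remaining axis is
  -- spatial because `1 ≤ n`, so it meets the hyperboloid.
  · refine exists_isIsometric_of_quadric (p := Fin.last _) (a := -H ^ 2) (fun i => ?_) hH ?_
      (Fin.last n) ?_ hg
    · have := i.2
      simp [twoTimeSign, lorentzSign, show i.val ≠ n + 1 by omega]
    · simp [twoTimeSign]
    · simp [lorentzSign, show n ≠ 0 by omega, hH]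
  · exact (NullFrame.standard hn).coneSection.exists_isIsometric
      (NullFrame.standard hn).pullback_param hg
  -- Anti-de Sitter space: fixing the last spatial coordinate, of index `n`, leaves both times; the
  -- axis of index `0` meets the hyperboloid.
  · refine exists_isIsometric_of_quadric (p := (Fin.last n).castSucc) (a := H ^ 2) (fun i => ?_)
      hH ?_ 0 ?_ hg
    · refine Fin.lastCases ?_ (fun i => ?_) i
      · simp [twoTimeSign]
      · have := i.2
        rw [Fin.succAbove_of_castSucc_lt _ _ (by simp [Fin.lt_def])]
        simp [twoTimeSign, show i.val ≠ n + 1 by omega,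
          show i.val ≠ n by omega]
    · simp [twoTimeSign, show n ≠ 0 by omega]
    · simp [twoTimeSign, hH]

end AdSM

end

theorem mainTheorem7 (n : ℕ) (hn : 1 ≤ n) :
    (∀ f : AdSM.HomogeneousFunction n,
      f.X = ∅ ∨ AdSM.IsConformallyFlat f.inducedMetric) ∧
    (∀ (M : Type*) [TopologicalSpace M] [ChartedSpace (AdSM.Coord n) M] [IsManifold (𝓡 n) ∞ M]
      (g : AdSM.MetricField n M), AdSM.IsGloballyConformallyAdSM g →
      ∃ f : AdSM.HomogeneousFunction n, AdSM.IsIsometric g f.inducedMetric) :=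
  -- Flatness is a condition at each point, hence vacuous when `X_f` is empty.
  ⟨fun f => Or.inr (f.isConformallyFlat hn), fun _ _ _ _ _ hg => hg.exists_isIsometric hn⟩
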